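/- Let $\mathbb F$ be an algebraically closed field of characteristic $0$ or $p>3$. A Lie algebra over $\mathbb F$ is called classical simple if it is obtained as follows: let $\mathfrak g_{\mathbb C}$ be a finite-dimensional simple Lie algebra over $\mathbb C$, let $\mathfrak g_{\mathbb Z}$ be the $\mathbb Z$-span of a Chevalley basis of $\mathfrak g_{\mathbb C}$ (which is a Lie algebra over $\mathbb Z$), let $\mathfrak g_{\mathbb F}=\mathfrak g_{\mathbb Z}\otimes_{\mathbb Z}\mathbb F$, and take the quotient $\mathfrak g_{\mathbb F}/\mathfrak z(\mathfrak g_{\mathbb F})$ by the centre (the centre is zero unless $\mathfrak g_{\mathbb C}$ has type $A_m$ and $p\mid m+1$, in which case the quotient is $\mathfrak{psl}_{m+1}$). Let $\mathfrak g=\mathfrak g_1\oplus\cdots\oplus\mathfrak g_n$ be a direct sum of classical simple Lie algebras over $\mathbb F$, and for each $k$ let $\pi_k\colon\mathfrak g\to\mathfrak g_k$ be the projection. Then for every $x\in\mathfrak g$ such that $\pi_k(x)\neq 0$ for all $k$, there exists $y\in\mathfrak g$ such that $\mathfrak g$ is generated, as a Lie algebra over $\mathbb F$, by $x$ and $y$.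 -/

import Mathlib

open scoped TensorProduct DirectSum

/-- A Chevalley basis of a finite-dimensional simple complex Lie algebra `g`, relative to a Cartan
subalgebra `H`. It consists of the simple coroots `h_i` of a base of the root system of `(g, H)`
together with root vectors `e α`, one for each root `α`, such that
* `[e α, e (-α)]` is the coroot of `α`;
* if `α`, `β` and `α + β` are roots, then `[e α, e β] = ± (r + 1) e (α + β)`, where `r` is the
  largest natural number such that `β - r α` is a root.

The remaining brackets are then determined: `[h, e α] = α(h) e α` because `e α` is a root vector,
and `[e α, e β] = 0` if `α + β` is neither zero nor a root. -/
structure ChevalleyBasis {g : Type*} [LieRing g] [LieAlgebra ℂ g] [FiniteDimensional ℂ g]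
    [LieAlgebra.IsSimple ℂ g] (H : LieSubalgebra ℂ g) [H.IsCartanSubalgebra] where
  /-- The simple roots. -/
  base : (LieAlgebra.IsKilling.rootSystem H).Base
  /-- The root vectors. -/
  e : H.root → g
  e_mem (α : H.root) : e α ∈ LieAlgebra.rootSpace H (α : LieModule.Weight ℂ H g)
  lie_e_neg (α β : H.root) (h : (β : LieModule.Weight ℂ H g) = -(α : LieModule.Weight ℂ H g)) :
    ⁅e α, e β⁆ = (LieAlgebra.IsKilling.coroot (α : LieModule.Weight ℂ H g) : g)
  lie_e_add (α β γ : H.root)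
    (h : ((γ : LieModule.Weight ℂ H g) : H → ℂ) =
      (α : LieModule.Weight ℂ H g) + (β : LieModule.Weight ℂ H g)) :
    ⁅e α, e β⁆ = (LieModule.chainBotCoeff (α : LieModule.Weight ℂ H g)
        (β : LieModule.Weight ℂ H g) + 1) • e γ ∨
    ⁅e α, e β⁆ = -((LieModule.chainBotCoeff (α : LieModule.Weight ℂ H g)
        (β : LieModule.Weight ℂ H g) + 1) • e γ)

namespace ChevalleyBasis

variable {g : Type*} [LieRing g] [LieAlgebra ℂ g] [FiniteDimensional ℂ g]
  [LieAlgebra.IsSimple ℂ g] {H : LieSubalgebra ℂ g} [H.IsCartanSubalgebra]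

/-- The elements of a Chevalley basis: simple coroots and root vectors. -/
def toSet (B : ChevalleyBasis H) : Set g :=
  (fun α : H.root => (LieAlgebra.IsKilling.coroot (α : LieModule.Weight ℂ H g) : g)) ''
    (B.base.support : Set H.root) ∪ Set.range B.e

theorem coroot_mem_span (B : ChevalleyBasis H) (α : H.root) :
    (LieAlgebra.IsKilling.coroot (α : LieModule.Weight ℂ H g) : g) ∈
      Submodule.span ℤ B.toSet := by
  have h := B.base.coroot_mem_span_int α
  have h2 := Submodule.mem_map_of_mem (f := (H.subtype : H →ₗ[ℂ] g).restrictScalars ℤ) h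
  rw [Submodule.map_span] at h2
  refine Submodule.span_mono ?_ h2
  rintro _ ⟨_, ⟨β, hβ, rfl⟩, rfl⟩
  exact Or.inl ⟨β, hβ, rfl⟩

theorem e_mem_span (B : ChevalleyBasis H) (α : H.root) :
    B.e α ∈ Submodule.span ℤ B.toSet :=
  Submodule.subset_span (Or.inr ⟨α, rfl⟩)

theorem lie_coroot_e (B : ChevalleyBasis H) (α β : H.root) :
    ∃ n : ℤ, ⁅(LieAlgebra.IsKilling.coroot (α : LieModule.Weight ℂ H g) : g), B.e β⁆ =
      n • B.e β := by
  obtain ⟨n, hn⟩ := (inferInstance :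
    (LieAlgebra.IsKilling.rootSystem H).IsCrystallographic).exists_value β α
  refine ⟨n, ?_⟩
  have h := LieAlgebra.IsKilling.lie_eq_smul_of_mem_rootSpace (B.e_mem β)
    (LieAlgebra.IsKilling.coroot (α : LieModule.Weight ℂ H g))
  rw [LieAlgebra.IsKilling.rootSystem_pairing_apply] at hn
  rw [← hn] at h
  change _ = (n : ℂ) • B.e β at h
  rw [Int.cast_smul_eq_zsmul] at h
  exact h

theorem lie_mem_span_of_mem (B : ChevalleyBasis H) {x y : g} (hx : x ∈ B.toSet)
    (hy : y ∈ B.toSet) : ⁅x, y⁆ ∈ Submodule.span ℤ B.toSet := by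
  rcases hx with ⟨α, -, rfl⟩ | ⟨α, rfl⟩ <;> rcases hy with ⟨β, -, rfl⟩ | ⟨β, rfl⟩
  · have h : ⁅LieAlgebra.IsKilling.coroot (α : LieModule.Weight ℂ H g),
        LieAlgebra.IsKilling.coroot (β : LieModule.Weight ℂ H g)⁆ = 0 :=
      LieModule.IsTrivial.trivial _ _
    have h2 := congrArg (fun z : H => (z : g)) h
    simp only [LieSubalgebra.coe_bracket, ZeroMemClass.coe_zero] at h2
    simp only [h2]
    exact Submodule.zero_mem _
  · obtain ⟨n, hn⟩ := B.lie_coroot_e α β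
    simp only [hn]
    exact Submodule.smul_mem _ _ (B.e_mem_span β)
  · obtain ⟨n, hn⟩ := B.lie_coroot_e β α
    rw [← lie_skew]
    simp only [hn]
    exact Submodule.neg_mem _ (Submodule.smul_mem _ _ (B.e_mem_span α))
  · by_cases h : (β : LieModule.Weight ℂ H g) = -(α : LieModule.Weight ℂ H g)
    · rw [B.lie_e_neg α β h]
      exact B.coroot_mem_span α
    · have hmem := LieAlgebra.lie_mem_genWeightSpace_of_mem_genWeightSpace (B.e_mem α) (B.e_mem β)
      by_cases hz : LieAlgebra.rootSpace H (((α : LieModule.Weight ℂ H g) : H → ℂ) +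
          (β : LieModule.Weight ℂ H g)) = ⊥
      · rw [LieAlgebra.rootSpace] at hz
        rw [hz] at hmem
        rw [(LieSubmodule.mem_bot _).mp hmem]
        exact Submodule.zero_mem _
      · let γ : LieModule.Weight ℂ H g := ⟨_, hz⟩
        have hγ : γ.IsNonZero := by
          intro h0
          apply h
          have h0' : ((α : LieModule.Weight ℂ H g) : H → ℂ) + (β : LieModule.Weight ℂ H g) = 0 := h0
          apply DFunLike.coe_injective
          rw [LieModule.Weight.coe_neg]
          exact eq_neg_of_add_eq_zero_right h0'
        let γ' : H.root := ⟨γ, by simpa using hγ⟩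
        rcases B.lie_e_add α β γ' rfl with h1 | h1
        · rw [h1]
          exact nsmul_mem (B.e_mem_span γ') _
        · rw [h1]
          exact Submodule.neg_mem _ (nsmul_mem (B.e_mem_span γ') _)

/-- The `ℤ`-span of a Chevalley basis, a Lie ring. -/
def integralForm (B : ChevalleyBasis H) : LieSubalgebra ℤ g where
  toSubmodule := Submodule.span ℤ B.toSet
  lie_mem' {x y} hx hy := by
    change x ∈ Submodule.span ℤ B.toSet at hx
    change y ∈ Submodule.span ℤ B.toSet at hy
    change ⁅x, y⁆ ∈ Submodule.span ℤ B.toSet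
    induction hx using Submodule.span_induction with
    | zero => simp
    | add u v _ _ hu hv => rw [add_lie]; exact Submodule.add_mem _ hu hv
    | smul t u _ hu => rw [smul_lie]; exact Submodule.smul_mem _ t hu
    | mem u hu =>
      induction hy using Submodule.span_induction with
      | zero => simp
      | add v w _ _ hv hw => rw [lie_add]; exact Submodule.add_mem _ hv hw
      | smul t v _ hv => rw [lie_smul]; exact Submodule.smul_mem _ t hv
      | mem v hv => exact B.lie_mem_span_of_mem hu hv

/-- The Lie algebra over `F` obtained from the `ℤ`-span of a Chevalley basis by extension of
scalars. -/
abbrev modularForm (F : Type*) [Field F] (B : ChevalleyBasis H) : Type _ :=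
  F ⊗[ℤ] B.integralForm

end ChevalleyBasis

/-- `L` is a classical simple Lie algebra over `F` (algebraically closed of characteristic `0` or
`p > 3`): it is isomorphic to the quotient by its centre of the Lie algebra over `F` obtained by
reduction of the `ℤ`-span of a Chevalley basis of a finite-dimensional simple complex Lie algebra.
The centre vanishes unless the type is `A_n` and `p` divides `n + 1`, in which case the Lie algebra
obtained by reduction is `sl_{n+1}` and its quotient is `psl_{n+1}`. -/
def IsClassicalSimple (F : Type*) [Field F] (L : Type*) [LieRing L] [LieAlgebra F L] : Prop :=
  ∃ (g : Type) (_ : LieRing g) (_ : LieAlgebra ℂ g) (_ : FiniteDimensional ℂ g)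
    (_ : LieAlgebra.IsSimple ℂ g) (H : LieSubalgebra ℂ g) (_ : H.IsCartanSubalgebra)
    (B : ChevalleyBasis H),
    Nonempty (L ≃ₗ⁅F⁆ (B.modularForm F ⧸ LieAlgebra.center F (B.modularForm F)))

/-! Call `x` full if its components along all root vectors can be taken nonzero. A full element
generates together with a generic Cartan element `y`. The roots take distinct nonzero values on `y`,
so a subspace containing `x` and stable under `ad y` contains every root vector; their brackets give
the coroots, and these together span (`IsFull.exists_lieSpan_eq_top`). Neither linear independence
nor irreducibility is needed, so frames pass to central quotients and direct sums, and it is enough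
to find in each summand a frame for which the given nonzero component is full.

For this, lift the component to a noncentral element of the reduced Chevalley algebra. The span of
its orbit under products of the automorphisms `exp (t ad e)`, `e` a root vector, is stable under
every `ad e`, so it is a noncentral ideal. It contains a root vector, and by irreducibility of the
root system all of them. Hence no root coordinate vanishes identically on the orbit. Coordinates
vary polynomially along suitable paths of automorphisms and the field is infinite, so one
automorphism makes all of them nonzero at once (`exists_isFull_of_notMem_center`). Its inverse
carries the standard frame to the required one. -/

open Polynomial

/-! ### Linear algebra -/

/-- If a submodule is stable under `f` and contains a sum of a vector killed by `f` and eigenvectors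
for distinct nonzero eigenvalues, it contains every eigenvector occurring in the sum. -/
theorem Submodule.mem_of_add_sum_smul_mem {F M ι : Type*} [Field F] [AddCommGroup M] [Module F M]
    [Fintype ι] (V : Submodule F M) (f : Module.End F M) (hf : ∀ v ∈ V, f v ∈ V)
    {l : ι → F} (hl : Function.Injective l) (hl0 : ∀ i, l i ≠ 0) {e : ι → M}
    (he : ∀ i, f (e i) = l i • e i) {v : M} (hv : f v = 0) (c : ι → F)
    (h : v + ∑ i, c i • e i ∈ V) {j : ι} (hj : c j ≠ 0) : e j ∈ V := by
  classical
  -- The factor `X` kills `v` and the product kills every `e i` with `i ≠ j`, so `p(f)` isolates a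
  -- nonzero multiple of `e j`.
  let p : F[X] := X * ∏ i ∈ Finset.univ.erase j, (X - C (l i))
  have hp : aeval f p (v + ∑ i, c i • e i) ∈ V := by
    have key : ∀ q : F[X], ∀ w ∈ V, aeval f q w ∈ V := by
      intro q
      induction q using Polynomial.induction_on' with
      | add q r hq hr => intro w hw; simpa using V.add_mem (hq w hw) (hr w hw)
      | monomial n a =>
        intro w hw
        have : (f ^ n) w ∈ V := by
          induction n with
          | zero => simpa
          | succ n ih => rw [pow_succ']; exact hf _ ih
        simpa [aeval_monomial] using V.smul_mem a this
    exact key p _ h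
  have hpe : ∀ i, aeval f p (e i) = p.eval (l i) • e i := fun i ↦
    Module.End.aeval_apply_of_mem_apply_eq_smul (he i)
  have hpv : aeval f p v = 0 := by
    rw [Module.End.aeval_apply_of_mem_apply_eq_smul (μ := (0 : F)) (by simpa using hv)]
    simp [p]
  have hp0 : ∀ i, i ≠ j → p.eval (l i) = 0 := by
    intro i hi
    simp only [p, eval_mul, eval_prod]
    rw [Finset.prod_eq_zero (i := i) (by simp [hi]) (by simp), mul_zero]
  have hpj : p.eval (l j) ≠ 0 := by
    simp only [p, eval_mul, eval_prod, eval_X, eval_sub, eval_C]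
    refine mul_ne_zero (hl0 j) (Finset.prod_ne_zero_iff.mpr fun i hi ↦ sub_ne_zero.mpr ?_)
    exact fun h ↦ (Finset.ne_of_mem_erase hi) (hl h).symm
  rw [map_add, hpv, zero_add, map_sum, Finset.sum_eq_single j] at hp
  · rw [map_smul, hpe, smul_smul] at hp
    exact (V.smul_mem_iff (mul_ne_zero hj hpj)).mp hp
  · intro i _ hi
    rw [map_smul, hpe, hp0 i hi, zero_smul, smul_zero]
  · simp

/-! ### Root frames -/

/-- A family of root vectors `e` and coroots `h` spanning a Lie algebra and satisfying the relations
of a split semisimple Lie algebra, such that distinct root vectors have distinct nonzero weights. -/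
structure RootFrame (F L ι : Type*) [Field F] [LieRing L] [LieAlgebra F L] where
  /-- The root vectors. -/
  e : ι → L
  /-- The coroots. -/
  h : ι → L
  /-- The value `a i j` of the root `j` on the coroot `i`. -/
  a : ι → ι → F
  span_eq : Submodule.span F (Set.range e ∪ Set.range h) = ⊤
  lie_h_e (i j : ι) : ⁅h i, e j⁆ = a i j • e j
  lie_h_h (i j : ι) : ⁅h i, h j⁆ = 0
  exists_lie_e (i : ι) : ∃ j, ⁅e i, e j⁆ = h i
  exists_ne_zero (j : ι) : ∃ i, a i j ≠ 0
  exists_ne (j k : ι) (hjk : j ≠ k) : ∃ i, a i j ≠ a i k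

namespace RootFrame

variable {F L L' ι : Type*} [Field F] [LieRing L] [LieAlgebra F L] [LieRing L'] [LieAlgebra F L']

/-- The image of a root frame under a surjective homomorphism. -/
def map (R : RootFrame F L ι) (f : L →ₗ⁅F⁆ L') (hf : Function.Surjective f) :
    RootFrame F L' ι where
  e i := f (R.e i)
  h i := f (R.h i)
  a := R.a
  span_eq := by
    have h := congrArg (Submodule.map (f : L →ₗ[F] L')) R.span_eq
    rw [Submodule.map_span, Submodule.map_top, LinearMap.range_eq_top.mpr hf, Set.image_union,
      ← Set.range_comp, ← Set.range_comp] at h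
    exact h
  lie_h_e i j := by rw [← LieHom.map_lie, R.lie_h_e, map_smul]
  lie_h_h i j := by rw [← LieHom.map_lie, R.lie_h_h, map_zero]
  exists_lie_e i := (R.exists_lie_e i).imp fun j hj ↦ by rw [← LieHom.map_lie, hj]
  exists_ne_zero := R.exists_ne_zero
  exists_ne := R.exists_ne

/-- The vectors all of whose root components are nonzero. -/
def IsFull [Fintype ι] (R : RootFrame F L ι) (x : L) : Prop :=
  ∃ c d : ι → F, (∀ i, c i ≠ 0) ∧ x = ∑ i, d i • R.h i + ∑ i, c i • R.e i

theorem IsFull.map [Fintype ι] {R : RootFrame F L ι} {x : L} (hx : R.IsFull x) (f : L →ₗ⁅F⁆ L')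
    (hf : Function.Surjective f) : (R.map f hf).IsFull (f x) := by
  obtain ⟨c, d, hc, rfl⟩ := hx
  exact ⟨c, d, hc, by simp [RootFrame.map]⟩

theorem exists_eq_sum [Fintype ι] (R : RootFrame F L ι) (x : L) :
    ∃ c d : ι → F, x = ∑ i, d i • R.h i + ∑ i, c i • R.e i := by
  have hx : x ∈ Submodule.span F (Set.range R.e ∪ Set.range R.h) := R.span_eq ▸ Submodule.mem_top
  rw [Submodule.span_union, Submodule.mem_sup] at hx
  obtain ⟨y, hy, z, hz, rfl⟩ := hx
  obtain ⟨c, rfl⟩ := (Submodule.mem_span_range_iff_exists_fun F).mp hy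
  obtain ⟨d, rfl⟩ := (Submodule.mem_span_range_iff_exists_fun F).mp hz
  exact ⟨c, d, add_comm _ _⟩

theorem lie_sum_h_e [Fintype ι] (R : RootFrame F L ι) (d : ι → F) (j : ι) :
    ⁅∑ i, d i • R.h i, R.e j⁆ = (∑ i, d i * R.a i j) • R.e j := by
  simp [sum_lie, smul_lie, R.lie_h_e, Finset.sum_smul, smul_smul]

theorem lie_sum_h_sum_h [Fintype ι] (R : RootFrame F L ι) (d d' : ι → F) :
    ⁅∑ i, d i • R.h i, ∑ i, d' i • R.h i⁆ = 0 := by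
  simp [sum_lie, lie_sum, R.lie_h_h]

/-- There is an element of the Cartan subalgebra on which the roots take distinct nonzero values. -/
theorem exists_generic [Infinite F] [Fintype ι] (R : RootFrame F L ι) :
    ∃ s : ι → F, (∀ j, ∑ i, s i * R.a i j ≠ 0) ∧
      Function.Injective fun j ↦ ∑ i, s i * R.a i j := by
  classical
  let φ : ι → Module.Dual F (ι → F) := fun j ↦ ∑ i, R.a i j • LinearMap.proj i
  have hφ : ∀ j s, φ j s = ∑ i, s i * R.a i j := by
    intro j s
    simp [φ, mul_comm]
  have hφ1 : ∀ i j, φ j (Pi.single i 1) = R.a i j := by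
    intro i j
    rw [hφ]
    simp [Pi.single_apply]
  -- The roots and their pairwise differences are finitely many nonzero functionals; over an
  -- infinite field some point avoids all their kernels.
  let ψ : ι ⊕ {q : ι × ι // q.1 ≠ q.2} → Module.Dual F (ι → F) :=
    Sum.elim φ fun q ↦ φ q.1.1 - φ q.1.2
  obtain ⟨s, hs⟩ := Module.Dual.exists_forall_ne_zero_of_forall_exists ψ (by
    rintro (j | ⟨⟨j, k⟩, hjk⟩)
    · obtain ⟨i, hi⟩ := R.exists_ne_zero j
      exact ⟨Pi.single i 1, by simpa [ψ, hφ1] using hi⟩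
    · obtain ⟨i, hi⟩ := R.exists_ne j k hjk
      exact ⟨Pi.single i 1, by simpa [ψ, hφ1, sub_eq_zero] using hi⟩)
  refine ⟨s, fun j ↦ by simpa [ψ, hφ] using hs (Sum.inl j), fun j k hjk ↦ ?_⟩
  by_contra hne
  refine hs (Sum.inr ⟨(j, k), hne⟩) ?_
  simpa [ψ, hφ, sub_eq_zero] using hjk

theorem e_mem_of_mem [Infinite F] [Fintype ι] (R : RootFrame F L ι) (V : Submodule F L)
    {s : ι → F} (hs0 : ∀ j, ∑ i, s i * R.a i j ≠ 0)
    (hs : Function.Injective fun j ↦ ∑ i, s i * R.a i j)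
    (hV : ∀ v ∈ V, ⁅∑ i, s i • R.h i, v⁆ ∈ V) {c d : ι → F}
    (hx : ∑ i, d i • R.h i + ∑ i, c i • R.e i ∈ V) {j : ι} (hj : c j ≠ 0) : R.e j ∈ V :=
  V.mem_of_add_sum_smul_mem (LieAlgebra.ad F L (∑ i, s i • R.h i)) hV hs hs0
    (fun i ↦ R.lie_sum_h_e s i) (R.lie_sum_h_sum_h s d) c hx hj

theorem IsFull.exists_lieSpan_eq_top [Infinite F] [Fintype ι] {R : RootFrame F L ι} {x : L}
    (hx : R.IsFull x) : ∃ y : L, LieSubalgebra.lieSpan F L {x, y} = ⊤ := by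
  obtain ⟨c, d, hc, rfl⟩ := hx
  obtain ⟨s, hs0, hs⟩ := R.exists_generic
  set x := ∑ i, d i • R.h i + ∑ i, c i • R.e i
  set y := ∑ i, s i • R.h i with hy
  refine ⟨y, ?_⟩
  set K := LieSubalgebra.lieSpan F L {x, y}
  have hxK : x ∈ K := LieSubalgebra.subset_lieSpan (by simp)
  have hyK : y ∈ K := LieSubalgebra.subset_lieSpan (by simp)
  have he : ∀ j, R.e j ∈ K := fun j ↦
    R.e_mem_of_mem K.toSubmodule hs0 hs (fun v hv ↦ K.lie_mem hyK hv) hxK (hc j)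
  have hh : ∀ j, R.h j ∈ K := fun j ↦ by
    obtain ⟨k, hk⟩ := R.exists_lie_e j
    exact hk ▸ K.lie_mem (he j) (he k)
  rw [← LieSubalgebra.toSubmodule_inj, LieSubalgebra.top_toSubmodule, eq_top_iff, ← R.span_eq,
    Submodule.span_le]
  rintro _ (⟨j, rfl⟩ | ⟨j, rfl⟩)
  exacts [he j, hh j]

section DirectSum

variable {κ : Type*} [Fintype κ] [DecidableEq κ] {A : κ → Type*} [∀ k, LieRing (A k)]
  [∀ k, LieAlgebra F (A k)] {ι : κ → Type*}

/-- The root frame of a finite direct sum. -/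
def directSum (R : ∀ k, RootFrame F (A k) (ι k)) : RootFrame F (⨁ k, A k) (Σ k, ι k) where
  e i := DirectSum.lieAlgebraOf F κ A i.1 ((R i.1).e i.2)
  h i := DirectSum.lieAlgebraOf F κ A i.1 ((R i.1).h i.2)
  a i j := if hij : i.1 = j.1 then (R j.1).a (hij ▸ i.2) j.2 else 0
  span_eq := by
    set S := Submodule.span F
      (Set.range (fun i : Σ k, ι k ↦ DirectSum.lieAlgebraOf F κ A i.1 ((R i.1).e i.2)) ∪
        Set.range (fun i : Σ k, ι k ↦ DirectSum.lieAlgebraOf F κ A i.1 ((R i.1).h i.2)))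
    refine Submodule.eq_top_iff'.mpr fun x ↦ ?_
    induction x using DirectSum.induction_on with
    | zero => exact S.zero_mem
    | add x y hx hy => exact S.add_mem hx hy
    | of k x =>
      have hx : x ∈ Submodule.span F (Set.range (R k).e ∪ Set.range (R k).h) :=
        (R k).span_eq ▸ Submodule.mem_top
      change DirectSum.lieAlgebraOf F κ A k x ∈ S
      induction hx using Submodule.span_induction with
      | zero => simp
      | add u v _ _ hu hv => rw [map_add]; exact S.add_mem hu hv
      | smul t u _ hu => rw [map_smul]; exact S.smul_mem t hu
      | mem u hu =>
        rcases hu with ⟨i, rfl⟩ | ⟨i, rfl⟩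
        · exact Submodule.subset_span (Or.inl ⟨⟨k, i⟩, rfl⟩)
        · exact Submodule.subset_span (Or.inr ⟨⟨k, i⟩, rfl⟩)
  lie_h_e := by
    rintro ⟨k, i⟩ ⟨l, j⟩
    by_cases hkl : k = l
    · subst hkl
      simp only [dite_true]
      rw [← LieHom.map_lie, (R k).lie_h_e, map_smul]
    · simp only [hkl, dite_false, zero_smul]
      exact DirectSum.lie_of_of_ne A hkl _ _
  lie_h_h := by
    rintro ⟨k, i⟩ ⟨l, j⟩
    by_cases hkl : k = l
    · subst hkl
      rw [← LieHom.map_lie, (R k).lie_h_h, map_zero]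
    · exact DirectSum.lie_of_of_ne A hkl _ _
  exists_lie_e := by
    rintro ⟨k, i⟩
    obtain ⟨j, hj⟩ := (R k).exists_lie_e i
    exact ⟨⟨k, j⟩, by rw [← LieHom.map_lie, hj]⟩
  exists_ne_zero := by
    rintro ⟨k, j⟩
    obtain ⟨i, hi⟩ := (R k).exists_ne_zero j
    exact ⟨⟨k, i⟩, by simpa using hi⟩
  exists_ne := by
    rintro ⟨k, j⟩ ⟨l, m⟩ hne
    by_cases hkl : k = l
    · subst hkl
      obtain ⟨i, hi⟩ := (R k).exists_ne j m (by rintro rfl; exact hne rfl)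
      exact ⟨⟨k, i⟩, by simpa using hi⟩
    -- A coroot of summand `k` on which `j` is nonzero separates the two roots, since `m` vanishes
    -- on it.
    · obtain ⟨i, hi⟩ := (R k).exists_ne_zero j
      exact ⟨⟨k, i⟩, by simpa [hkl] using hi⟩

theorem IsFull.directSum [∀ k, Fintype (ι k)] {R : ∀ k, RootFrame F (A k) (ι k)}
    {x : ⨁ k, A k} (hx : ∀ k, (R k).IsFull (x k)) : (RootFrame.directSum R).IsFull x := by
  choose c d hc hx using hx
  refine ⟨fun i ↦ c i.1 i.2, fun i ↦ d i.1 i.2, fun i ↦ hc i.1 i.2, ?_⟩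
  rw [Fintype.sum_sigma, Fintype.sum_sigma, ← Finset.sum_add_distrib]
  have : ∀ k, DirectSum.lieAlgebraOf F κ A k (x k) =
      ∑ i, d k i • (RootFrame.directSum R).h ⟨k, i⟩ +
        ∑ i, c k i • (RootFrame.directSum R).e ⟨k, i⟩ := by
    intro k
    conv_lhs => rw [hx k, map_add, map_sum, map_sum]
    simp only [map_smul]
    rfl
  rw [← Finset.sum_congr rfl fun k _ ↦ this k]
  exact (DirectSum.sum_univ_of x).symm

end DirectSum

end RootFrame

/-! ### Exponentials of derivations of nilpotency order four -/

section CubicExp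

variable {F L : Type*} [Field F] [LieRing L] [LieAlgebra F L]

/-- The identities satisfied by `ad z` which make its truncated exponential an automorphism. The
last two follow from the first one if `10` is invertible. -/
structure IsExponentiable (z : L) : Prop where
  lie_four (x : L) : ⁅z, ⁅z, ⁅z, ⁅z, x⁆⁆⁆⁆ = 0
  lie_five (x y : L) : ⁅⁅z, ⁅z, x⁆⁆, ⁅z, ⁅z, ⁅z, y⁆⁆⁆⁆ + ⁅⁅z, ⁅z, ⁅z, x⁆⁆⁆, ⁅z, ⁅z, y⁆⁆⁆ = 0
  lie_six (x y : L) : ⁅⁅z, ⁅z, ⁅z, x⁆⁆⁆, ⁅z, ⁅z, ⁅z, y⁆⁆⁆⁆ = 0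

variable (F) in
/-- The truncated exponential of `t • ad z`. -/
def cubicExp (z : L) (t : F) : Module.End F L :=
  1 + t • LieAlgebra.ad F L z + (t ^ 2 / 2) • LieAlgebra.ad F L z ^ 2 +
    (t ^ 3 / 6) • LieAlgebra.ad F L z ^ 3

theorem cubicExp_apply (z : L) (t : F) (x : L) : cubicExp F z t x =
    x + t • ⁅z, x⁆ + (t ^ 2 / 2) • ⁅z, ⁅z, x⁆⁆ + (t ^ 3 / 6) • ⁅z, ⁅z, ⁅z, x⁆⁆⁆ := by
  simp [cubicExp, pow_succ]

theorem cubicExp_neg_apply_apply [NeZero (2 : F)] [NeZero (3 : F)] {z : L}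
    (hz : IsExponentiable z) (t : F) (x : L) : cubicExp F z (-t) (cubicExp F z t x) = x := by
  have h2 : (2 : F) ≠ 0 := NeZero.ne _
  have h3 : (3 : F) ≠ 0 := NeZero.ne _
  have h6 : (6 : F) ≠ 0 := by
    rw [show (6 : F) = 2 * 3 by norm_num]
    exact mul_ne_zero h2 h3
  simp only [cubicExp_apply, lie_add, lie_smul, hz.lie_four, smul_zero, add_zero]
  match_scalars <;> field_simp <;> ring

theorem cubicExp_lie [NeZero (2 : F)] [NeZero (3 : F)] {z : L} (hz : IsExponentiable z) (t : F)
    (x y : L) : cubicExp F z t ⁅x, y⁆ = ⁅cubicExp F z t x, cubicExp F z t y⁆ := by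
  have h2 : (2 : F) ≠ 0 := NeZero.ne _
  have h3 : (3 : F) ≠ 0 := NeZero.ne _
  have h6 : (6 : F) ≠ 0 := by
    rw [show (6 : F) = 2 * 3 by norm_num]
    exact mul_ne_zero h2 h3
  obtain ⟨D, hD⟩ : ∃ D : L →ₗ[F] L, ∀ x, ⁅z, x⁆ = D x := ⟨LieAlgebra.ad F L z, fun _ ↦ rfl⟩
  have hD' : ∀ x y, D ⁅x, y⁆ = ⁅D x, y⁆ + ⁅x, D y⁆ := fun x y ↦ by
    simp only [← hD, leibniz_lie z x y]
  have e3 : ∀ x, D (D (D (D x))) = 0 := fun x ↦ by simpa only [hD] using hz.lie_four x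
  have e4 := e3 ⁅x, y⁆
  have e5 := hz.lie_five x y
  have e6 := hz.lie_six x y
  simp only [hD] at e5 e6
  simp only [hD', map_add, e3, zero_lie, lie_zero] at e4
  simp only [cubicExp_apply, hD, lie_add, add_lie, lie_smul, smul_lie, hD', map_add]
  -- The terms of bidegree `(i, j)` with `i + j ≥ 4` must vanish. Those of total degree 4 form
  -- `D⁴⁅x, y⁆ / 24`; those of degrees 5 and 6 are the two extra identities, divided by 12 and 36.
  linear_combination (norm := (match_scalars <;> field_simp <;> ring))
    (-(t ^ 4 / (2 * 2 * 2 * 3))) • e4 - (t ^ 5 / (2 * 2 * 3)) • e5 - (t ^ 6 / (2 * 2 * 3 * 3)) • e6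

/-- The truncated exponential of `t • ad z` as an automorphism. -/
def cubicExpEquiv [NeZero (2 : F)] [NeZero (3 : F)] {z : L} (hz : IsExponentiable z) (t : F) :
    L ≃ₗ⁅F⁆ L :=
  { cubicExp F z t with
    map_lie' := fun {x y} ↦ cubicExp_lie hz t x y
    invFun := cubicExp F z (-t)
    left_inv := cubicExp_neg_apply_apply hz t
    right_inv := fun x ↦ by simpa using cubicExp_neg_apply_apply hz (-t) x }

theorem cubicExpEquiv_apply [NeZero (2 : F)] [NeZero (3 : F)] {z : L} (hz : IsExponentiable z)
    (t : F) (x : L) : cubicExpEquiv hz t x = cubicExp F z t x := rfl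

/-- A subspace stable under `exp (t ad z)` for all `t` is stable under `ad z`. -/
theorem lie_mem_of_cubicExp_mem [NeZero (2 : F)] [NeZero (3 : F)] (z : L) (V : Submodule F L)
    {v : L} (hV : ∀ t : F, cubicExp F z t v ∈ V) : ⁅z, v⁆ ∈ V := by
  have h2 : (2 : F) ≠ 0 := NeZero.ne _
  have h3 : (3 : F) ≠ 0 := NeZero.ne _
  have h6 : (6 : F) ≠ 0 := by
    rw [show (6 : F) = 2 * 3 by norm_num]
    exact mul_ne_zero h2 h3
  -- Odd parts at `t = 1` and `t = 2`: the weights `8` and `-1` cancel the cubic terms and leave `12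
  -- • ⁅z, v⁆`.
  have h : ⁅z, v⁆ = (2 * 2 * 3 : F)⁻¹ • ((8 : F) • (cubicExp F z 1 v - cubicExp F z (-1) v) -
      (cubicExp F z 2 v - cubicExp F z (-2) v)) := by
    simp only [cubicExp_apply]
    match_scalars <;> field_simp <;> ring
  rw [h]
  exact V.smul_mem _ (V.sub_mem (V.smul_mem _ (V.sub_mem (hV _) (hV _)))
    (V.sub_mem (hV _) (hV _)))

end CubicExp

/-! ### Polynomial families of automorphisms -/

section PolynomialPath

variable {F L : Type*} [Field F] [LieRing L] [LieAlgebra F L]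

/-- A curve in a vector space all of whose coordinates are polynomial functions. -/
def IsPolynomialCurve (ξ : F → L) : Prop :=
  ∀ f : Module.Dual F L, ∃ q : F[X], ∀ s, f (ξ s) = q.eval s

theorem isPolynomialCurve_const (x : L) : IsPolynomialCurve fun _ : F ↦ x :=
  fun f ↦ ⟨C (f x), by simp⟩

theorem IsPolynomialCurve.add {ξ ζ : F → L} (hξ : IsPolynomialCurve ξ)
    (hζ : IsPolynomialCurve ζ) : IsPolynomialCurve fun s ↦ ξ s + ζ s := fun f ↦ by
  obtain ⟨p, hp⟩ := hξ f
  obtain ⟨q, hq⟩ := hζ f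
  exact ⟨p + q, by simp [hp, hq]⟩

theorem IsPolynomialCurve.smul {ξ : F → L} (hξ : IsPolynomialCurve ξ) (p : F[X]) :
    IsPolynomialCurve fun s ↦ p.eval s • ξ s := fun f ↦ by
  obtain ⟨q, hq⟩ := hξ f
  exact ⟨p * q, by simp [hq]⟩

theorem IsPolynomialCurve.lie {ξ : F → L} (hξ : IsPolynomialCurve ξ) (z : L) :
    IsPolynomialCurve fun s ↦ ⁅z, ξ s⁆ := fun f ↦ hξ (f ∘ₗ LieAlgebra.ad F L z)

/-- A polynomial path of automorphisms starting at the identity. -/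
structure IsPolynomialPath (γ : F → L ≃ₗ⁅F⁆ L) : Prop where
  zero_apply (x : L) : γ 0 x = x
  curve {ξ : F → L} (hξ : IsPolynomialCurve ξ) (q : F[X]) :
    IsPolynomialCurve fun s ↦ γ (q.eval s) (ξ s)

theorem isPolynomialPath_refl : IsPolynomialPath fun _ : F ↦ (LieEquiv.refl : L ≃ₗ⁅F⁆ L) :=
  ⟨fun _ ↦ rfl, fun hξ _ ↦ hξ⟩

/-- The scale factors make any composite of points on two paths the time-1 point of a third. -/
theorem IsPolynomialPath.trans {γ δ : F → L ≃ₗ⁅F⁆ L} (hγ : IsPolynomialPath γ)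
    (hδ : IsPolynomialPath δ) (a b : F) :
    IsPolynomialPath fun s ↦ (γ (s * a)).trans (δ (s * b)) where
  zero_apply x := by simp [hγ.zero_apply, hδ.zero_apply]
  curve {ξ} hξ q := by
    have h := hδ.curve (hγ.curve hξ (q * C a)) (q * C b)
    simpa using h

theorem isPolynomialPath_cubicExpEquiv [NeZero (2 : F)] [NeZero (3 : F)] {z : L}
    (hz : IsExponentiable z) (t : F) :
    IsPolynomialPath fun s ↦ cubicExpEquiv hz (s * t) where
  zero_apply x := by simp [cubicExpEquiv_apply, cubicExp_apply]
  curve {ξ} hξ q := by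
    have h := ((hξ.add ((hξ.lie z).smul (q * C t))).add
      (((hξ.lie z).lie z).smul (C 2⁻¹ * (q * C t) ^ 2))).add
      ((((hξ.lie z).lie z).lie z).smul (C 6⁻¹ * (q * C t) ^ 3))
    simpa [cubicExpEquiv_apply, cubicExp_apply, div_eq_inv_mul] using h

/-- If each of finitely many functionals is nonzero somewhere on the orbit of `x`, they are all
nonzero at some point of the orbit. -/
theorem exists_isPolynomialPath_forall_ne_zero [Infinite F] {ι : Type*} (S : Finset ι)
    (f : ι → Module.Dual F L) (x : L)
    (h : ∀ i ∈ S, ∃ γ : F → L ≃ₗ⁅F⁆ L, IsPolynomialPath γ ∧ f i (γ 1 x) ≠ 0) :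
    ∃ γ : F → L ≃ₗ⁅F⁆ L, IsPolynomialPath γ ∧ ∀ i ∈ S, f i (γ 1 x) ≠ 0 := by
  classical
  induction S using Finset.induction_on with
  | empty => exact ⟨_, isPolynomialPath_refl, by simp⟩
  | insert j S _ ih =>
    obtain ⟨γ, hγ, hγx⟩ := ih fun i hi ↦ h i (Finset.mem_insert_of_mem hi)
    obtain ⟨δ, hδ, hδx⟩ := h j (Finset.mem_insert_self j S)
    -- This curve joins `γ 1 x` at `s = 0` to `δ 1 x` at `s = 1`, so each coordinate along it is a
    -- nonzero polynomial.
    have hcurve : IsPolynomialCurve fun s : F ↦ δ s (γ (1 - s) x) := by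
      convert hδ.curve (hγ.curve (isPolynomialCurve_const x) (1 - X)) X using 1
      funext s
      rw [eval_sub, eval_one, eval_X]
    choose q hq using fun i ↦ hcurve (f i)
    beta_reduce at hq
    have hne : ∀ i ∈ insert j S, q i ≠ 0 := by
      intro i hi h0
      rcases Finset.mem_insert.mp hi with rfl | hi
      · have := hq i 1
        rw [h0, sub_self, hγ.zero_apply] at this
        exact hδx (by simpa using this)
      · have := hq i 0
        rw [h0, sub_zero, hδ.zero_apply] at this
        exact hγx i hi (by simpa using this)
    obtain ⟨s, hs⟩ : ∃ s, (∏ i ∈ insert j S, q i).eval s ≠ 0 := by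
      by_contra! h0
      exact Finset.prod_ne_zero_iff.mpr hne (Polynomial.funext fun s ↦ by simpa using h0 s)
    refine ⟨_, hγ.trans hδ (1 - s) s, fun i hi ↦ ?_⟩
    rw [eval_prod, Finset.prod_ne_zero_iff] at hs
    simpa [hq] using hs i hi

variable (F) in
/-- The span of the orbit of `x`. -/
def orbitSpan (x : L) : Submodule F L :=
  Submodule.span F {y | ∃ γ : F → L ≃ₗ⁅F⁆ L, IsPolynomialPath γ ∧ y = γ 1 x}

theorem mem_orbitSpan (x : L) : x ∈ orbitSpan F x :=
  Submodule.subset_span ⟨_, isPolynomialPath_refl, rfl⟩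

theorem lie_mem_orbitSpan [NeZero (2 : F)] [NeZero (3 : F)] {z : L} (hz : IsExponentiable z)
    (x : L) {v : L} (hv : v ∈ orbitSpan F x) : ⁅z, v⁆ ∈ orbitSpan F x := by
  refine lie_mem_of_cubicExp_mem z _ fun t ↦ ?_
  induction hv using Submodule.span_induction with
  | zero => simp
  | add u w _ _ hu hw => rw [map_add]; exact Submodule.add_mem _ hu hw
  | smul a u _ hu => rw [map_smul]; exact Submodule.smul_mem _ a hu
  | mem u hu =>
    obtain ⟨γ, hγ, rfl⟩ := hu
    refine Submodule.subset_span
      ⟨_, hγ.trans (isPolynomialPath_cubicExpEquiv hz t) 1 1, ?_⟩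
    simp [cubicExpEquiv_apply]

end PolynomialPath

/-! ### Making all root components of a noncentral element nonzero -/

namespace RootFrame

variable {F L ι : Type*} [Field F] [LieRing L] [LieAlgebra F L] [Fintype ι]

theorem mem_center (R : RootFrame F L ι) {x : L} (he : ∀ i, ⁅x, R.e i⁆ = 0)
    (hh : ∀ i, ⁅x, R.h i⁆ = 0) : x ∈ LieAlgebra.center F L := by
  rw [LieModule.mem_maxTrivSubmodule]
  intro y
  obtain ⟨c, d, rfl⟩ := R.exists_eq_sum y
  rw [← lie_skew]
  simp [lie_sum, he, hh]

/-- An ideal which is not central contains a root vector. -/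
theorem exists_e_mem [Infinite F] (R : RootFrame F L ι) {V : Submodule F L}
    (he : ∀ i, ∀ v ∈ V, ⁅R.e i, v⁆ ∈ V) (hh : ∀ i, ∀ v ∈ V, ⁅R.h i, v⁆ ∈ V) {x : L} (hx : x ∈ V)
    (hx' : x ∉ LieAlgebra.center F L) : ∃ i, R.e i ∈ V := by
  obtain ⟨c, d, rfl⟩ := R.exists_eq_sum x
  -- If `x` lies in the Cartan part, `⁅e j, x⁆` is a multiple of `e j`; were no root vector in `V`,
  -- all these brackets would vanish and `x` would be central. Otherwise a generic Cartan element
  -- isolates a root vector.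
  by_cases hc : ∀ i, c i = 0
  · simp only [hc, zero_smul, Finset.sum_const_zero, add_zero] at hx hx'
    by_contra! hV
    refine hx' (R.mem_center (fun j ↦ ?_) fun j ↦ ?_)
    · have h := he j _ hx
      rw [← lie_skew, V.neg_mem_iff, R.lie_sum_h_e] at h
      rw [R.lie_sum_h_e]
      by_contra h0
      exact hV j ((V.smul_mem_iff fun h1 ↦ h0 (by rw [h1, zero_smul])).mp h)
    · simp [sum_lie, R.lie_h_h]
  · push Not at hc
    obtain ⟨j, hj⟩ := hc
    obtain ⟨s, hs0, hs⟩ := R.exists_generic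
    refine ⟨j, R.e_mem_of_mem V hs0 hs (fun v hv ↦ ?_) hx hj⟩
    rw [sum_lie]
    exact V.sum_mem fun i _ ↦ by
      rw [smul_lie]
      exact V.smul_mem _ (hh i v hv)

/-- A root frame is connected if the graph of non-orthogonality of its roots is. -/
def IsConnected (R : RootFrame F L ι) : Prop :=
  ∀ S : Set ι, S.Nonempty → (∀ i ∈ S, ∀ j, R.a i j ≠ 0 → j ∈ S) → S = Set.univ

/-- A noncentral element has an automorphic image with nonzero components on all root vectors. -/
theorem exists_isFull_of_notMem_center [Infinite F] [NeZero (2 : F)] [NeZero (3 : F)]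
    (R : RootFrame F L ι) (hR : R.IsConnected) (hexp : ∀ i, IsExponentiable (R.e i))
    (coord : ι → Module.Dual F L) (coord_h : ∀ i j, coord i (R.h j) = 0)
    (coord_e : ∀ i j, coord i (R.e j) ≠ 0 ↔ i = j) {x : L} (hx : x ∉ LieAlgebra.center F L) :
    ∃ σ : L ≃ₗ⁅F⁆ L, R.IsFull (σ x) := by
  set V := orbitSpan F x
  have he : ∀ i, ∀ v ∈ V, ⁅R.e i, v⁆ ∈ V := fun i v hv ↦ lie_mem_orbitSpan (hexp i) x hv
  have hh : ∀ i, ∀ v ∈ V, ⁅R.h i, v⁆ ∈ V := fun i v hv ↦ by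
    obtain ⟨j, hj⟩ := R.exists_lie_e i
    rw [← hj, lie_lie]
    exact V.sub_mem (he _ _ (he _ _ hv)) (he _ _ (he _ _ hv))
  -- If `e i ∈ V` then `h i ∈ V`, and bracketing with `e j` gives `e j ∈ V` whenever `a i j ≠ 0`;
  -- connectedness does the rest.
  have hV : {i | R.e i ∈ V} = Set.univ := by
    refine hR _ (R.exists_e_mem he hh (mem_orbitSpan x) hx) fun i hi j hij ↦ ?_
    obtain ⟨k, hk⟩ := R.exists_lie_e i
    have h : R.h i ∈ V := by
      rw [← hk, ← lie_skew]
      exact V.neg_mem (he _ _ hi)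
    have h' := he j _ h
    rw [← lie_skew, R.lie_h_e, V.neg_mem_iff] at h'
    exact (V.smul_mem_iff hij).mp h'
  obtain ⟨γ, -, hγ⟩ := exists_isPolynomialPath_forall_ne_zero Finset.univ coord x fun i _ ↦ by
    by_contra! h0
    have hle : V ≤ LinearMap.ker (coord i) := Submodule.span_le.mpr fun y ⟨γ, hγ, hy⟩ ↦ by
      rw [hy]
      exact h0 γ hγ
    exact (coord_e i i).mpr rfl (hle (Set.eq_univ_iff_forall.mp hV i))
  obtain ⟨c, d, hcd⟩ := R.exists_eq_sum (γ 1 x)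
  refine ⟨γ 1, c, d, fun i hi ↦ hγ i (Finset.mem_univ i) ?_, hcd⟩
  rw [hcd, map_add, map_sum, map_sum, Finset.sum_eq_zero, Finset.sum_eq_zero, zero_add]
  · intro j _
    by_cases hij : i = j
    · rw [← hij, hi, zero_smul, map_zero]
    · rw [map_smul, not_not.mp ((not_iff_not.mpr (coord_e i j)).mpr hij), smul_zero]
  · intro j _
    rw [map_smul, coord_h, smul_zero]

end RootFrame

/-! ### Reductions of Chevalley bases -/

namespace ChevalleyBasis

open LieAlgebra LieAlgebra.IsKilling LieModule

variable {g : Type*} [LieRing g] [LieAlgebra ℂ g] [FiniteDimensional ℂ g]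
  [LieAlgebra.IsSimple ℂ g] {H : LieSubalgebra ℂ g} [H.IsCartanSubalgebra]

omit [LieAlgebra.IsSimple ℂ g] in
theorem isNonZero_coe (α : H.root) : (α : Weight ℂ H g).IsNonZero := by
  obtain ⟨α, hα⟩ := α
  simpa using hα

theorem root_apply_coroot (α β : H.root) :
    (β : Weight ℂ H g) (coroot (α : Weight ℂ H g)) = ((rootSystem H).pairingIn ℤ β α : ℂ) := by
  rw [← rootSystem_pairing_apply, ← (rootSystem H).algebraMap_pairingIn ℤ]
  rfl

theorem exists_weight_apply_coroot_eq (α : H.root) (χ : Weight ℂ H g) :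
    ∃ m : ℤ, -3 ≤ m ∧ m ≤ 3 ∧ χ (coroot (α : Weight ℂ H g)) = m := by
  by_cases hχ : χ.IsZero
  · exact ⟨0, by norm_num, by norm_num, by simp [hχ.eq]⟩
  · let β : H.root := ⟨χ, by simpa using hχ⟩
    refine ⟨(rootSystem H).pairingIn ℤ β α, ?_, ?_, root_apply_coroot α β⟩ <;>
    · have := (rootSystem H).pairingIn_pairingIn_mem_set_of_isCrystal_of_isRed β α
      simp only [Set.mem_insert_iff, Set.mem_singleton_iff, Prod.mk.injEq] at this
      omega

/-- Adding `α` four times raises the value on the coroot of `α` by 8, while all weights take values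
between -3 and 3 there. -/
theorem lie_e_lie_e_lie_e_lie_e (B : ChevalleyBasis H) (α : H.root) (x : g) :
    ⁅B.e α, ⁅B.e α, ⁅B.e α, ⁅B.e α, x⁆⁆⁆⁆ = 0 := by
  have hx : x ∈ ⨆ χ : Weight ℂ H g, genWeightSpace g χ :=
    (iSup_genWeightSpace_eq_top' ℂ H g) ▸ LieSubmodule.mem_top x
  induction hx using LieSubmodule.iSup_induction' with
  | zero => simp
  | add y z _ _ hy hz => simp only [lie_add, hy, hz, add_zero]
  | mem χ y hy =>
    have hlie : ∀ {χ : H → ℂ} {y : g}, y ∈ rootSpace H χ →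
        ⁅B.e α, y⁆ ∈ rootSpace H ((α : Weight ℂ H g) + χ) := fun hy ↦
      lie_mem_genWeightSpace_of_mem_genWeightSpace (B.e_mem α) hy
    have h4 := hlie (hlie (hlie (hlie hy)))
    suffices h : rootSpace H (((α : Weight ℂ H g) : H → ℂ) + ((α : Weight ℂ H g) +
        ((α : Weight ℂ H g) + ((α : Weight ℂ H g) + χ)))) = ⊥ by
      rw [h] at h4
      exact (LieSubmodule.mem_bot _).mp h4
    by_contra h
    obtain ⟨m, hm, hm', hχ⟩ := exists_weight_apply_coroot_eq α χ
    obtain ⟨n, hn, hn', hψ⟩ := exists_weight_apply_coroot_eq α ⟨_, h⟩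
    have hα : (α : Weight ℂ H g) (coroot (α : Weight ℂ H g)) = 2 := by
      rw [root_apply_coroot, RootPairing.pairingIn_same]
      rfl
    simp only [Weight.coe_weight_mk, Pi.add_apply, hα, hχ] at hψ
    have : 2 + (2 + (2 + (2 + m))) = n := by exact_mod_cast hψ
    omega

/-- The Chevalley root vectors as elements of the integral form. -/
def intE (B : ChevalleyBasis H) (α : H.root) : B.integralForm := ⟨B.e α, B.e_mem_span α⟩

/-- The coroots as elements of the integral form. -/
noncomputable def intH (B : ChevalleyBasis H) (α : H.root) : B.integralForm :=
  ⟨(coroot (α : Weight ℂ H g) : g), B.coroot_mem_span α⟩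

theorem span_intE_intH (B : ChevalleyBasis H) :
    Submodule.span ℤ (Set.range B.intE ∪ Set.range B.intH) = ⊤ := by
  refine Submodule.eq_top_iff'.mpr fun x ↦ ?_
  obtain ⟨x, hx⟩ := x
  change x ∈ Submodule.span ℤ B.toSet at hx
  induction hx using Submodule.span_induction with
  | zero => exact Submodule.zero_mem _
  | add u v _ _ hu hv => exact Submodule.add_mem _ hu hv
  | smul t u _ hu => exact Submodule.smul_mem _ t hu
  | mem u hu =>
    rcases hu with ⟨α, -, rfl⟩ | ⟨α, rfl⟩
    · exact Submodule.subset_span (Or.inr ⟨α, rfl⟩)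
    · exact Submodule.subset_span (Or.inl ⟨α, rfl⟩)

theorem lie_intH_intE (B : ChevalleyBasis H) (α β : H.root) :
    ⁅B.intH α, B.intE β⁆ = (rootSystem H).pairingIn ℤ β α • B.intE β := by
  apply Subtype.ext
  have h := lie_eq_smul_of_mem_rootSpace (B.e_mem β) (coroot (α : Weight ℂ H g))
  rw [root_apply_coroot, Int.cast_smul_eq_zsmul] at h
  exact h

theorem lie_intH_intH (B : ChevalleyBasis H) (α β : H.root) : ⁅B.intH α, B.intH β⁆ = 0 := by
  apply Subtype.ext
  have h : ⁅coroot (α : Weight ℂ H g), coroot (β : Weight ℂ H g)⁆ = 0 :=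
    LieModule.IsTrivial.trivial _ _
  exact congrArg (fun z : H ↦ (z : g)) h

theorem exists_lie_intE (B : ChevalleyBasis H) (α : H.root) :
    ∃ β, ⁅B.intE α, B.intE β⁆ = B.intH α :=
  ⟨⟨-(α : Weight ℂ H g), by simpa using isNonZero_coe α⟩, Subtype.ext (B.lie_e_neg _ _ rfl)⟩

/-- Expanding `D⁵⁅x, y⁆ = 0` and `D⁶⁅x, y⁆ = 0` gives 10 and 20 times the required identities.
Cancelling these factors over `ℤ`, where there is no torsion, keeps the identities valid in
characteristic 5. -/
theorem isExponentiable_intE (B : ChevalleyBasis H) (α : H.root) :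
    IsExponentiable (B.intE α) := by
  obtain ⟨D, hD⟩ : ∃ D : B.integralForm →ₗ[ℤ] B.integralForm, ∀ x, ⁅B.intE α, x⁆ = D x :=
    ⟨LieAlgebra.ad ℤ _ (B.intE α), fun _ ↦ rfl⟩
  have hD' : ∀ x y, D ⁅x, y⁆ = ⁅D x, y⁆ + ⁅x, D y⁆ := fun x y ↦ by
    simp only [← hD, leibniz_lie (B.intE α) x y]
  have h4 : ∀ x, D (D (D (D x))) = 0 := fun x ↦ by
    simp only [← hD]
    exact Subtype.ext (B.lie_e_lie_e_lie_e_lie_e α x)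
  have htor : ∀ (n : ℤ), n ≠ 0 → ∀ x : B.integralForm, n • x = 0 → x = 0 := fun n hn x hx ↦ by
    have h : n • (x : g) = 0 := congrArg Subtype.val hx
    rw [← Int.cast_smul_eq_zsmul ℂ] at h
    exact Subtype.ext ((smul_eq_zero.mp h).resolve_left (by exact_mod_cast hn))
  refine ⟨fun x ↦ by simpa only [hD] using h4 x, fun x y ↦ ?_, fun x y ↦ ?_⟩
  · have h5 : D (D (D (D (D ⁅x, y⁆)))) = 0 := h4 _
    simp only [hD', map_add, h4, zero_lie, lie_zero, map_zero] at h5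
    simp only [hD]
    refine htor 10 (by norm_num) _ (Eq.trans ?_ h5)
    module
  · have h6 : D (D (D (D (D (D ⁅x, y⁆))))) = 0 := h4 _
    simp only [hD', map_add, h4, zero_lie, lie_zero, map_zero] at h6
    simp only [hD]
    refine htor 20 (by norm_num) _ (Eq.trans ?_ h6)
    module

theorem _root_.LinearMap.exists_intCast_eq {A : Type*} [AddCommGroup A] (φ : A →ₗ[ℤ] ℂ)
    (h : ∀ x, ∃ n : ℤ, (n : ℂ) = φ x) : ∃ f : A →ₗ[ℤ] ℤ, ∀ x, (f x : ℂ) = φ x := by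
  choose f hf using h
  exact ⟨(AddMonoidHom.mk' f fun x y ↦ by
    exact_mod_cast show (f (x + y) : ℂ) = f x + f y by rw [hf, hf, hf, map_add]).toIntLinearMap, hf⟩

/-- The coordinate functional of a root vector. -/
theorem exists_complex_coord (B : ChevalleyBasis H) (α : H.root) :
    ∃ φ : g →ₗ[ℂ] ℂ, (∀ β : H.root, φ (coroot (β : Weight ℂ H g) : g) = 0) ∧ φ (B.e α) = 1 ∧
      ∀ β, β ≠ α → φ (B.e β) = 0 := by
  let α' : H.root := ⟨-(α : Weight ℂ H g), by simpa using isNonZero_coe α⟩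
  have hmem : B.e α' ∈ rootSpace H (-((α : Weight ℂ H g) : H → ℂ)) := by
    rw [← Weight.coe_neg]
    exact B.e_mem α'
  have hne : killingForm ℂ g (B.e α') (B.e α) ≠ 0 := by
    intro h0
    have h1 := B.lie_e_neg α α' rfl
    rw [lie_eq_killingForm_smul_of_mem_rootSpace_of_mem_rootSpace_neg (B.e_mem α) hmem,
      LieModule.traceForm_comm, h0, zero_smul] at h1
    have h2 : coroot (α : Weight ℂ H g) = 0 := Subtype.ext h1.symm
    rw [coroot_eq_zero_iff] at h2
    exact isNonZero_coe α h2
  -- Normalised Killing pairing with the root vector of `-α`, which is orthogonal to every weight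
  -- space other than that of `α`.
  let φ : g →ₗ[ℂ] ℂ := (killingForm ℂ g (B.e α') (B.e α))⁻¹ • killingForm ℂ g (B.e α')
  have hφe : φ (B.e α) = 1 := by simp [φ, hne]
  have hφe' : ∀ β, β ≠ α → φ (B.e β) = 0 := by
    intro β hβ
    have h := killingForm_apply_eq_zero_of_mem_rootSpace_of_add_ne_zero ℂ g H hmem (B.e_mem β)
      (by
        intro h0
        apply hβ
        apply Subtype.ext
        apply DFunLike.coe_injective
        rw [neg_add_eq_zero] at h0
        exact h0.symm)
    simp [φ, h]
  have hφh : ∀ β : H.root, φ (coroot (β : Weight ℂ H g) : g) = 0 := by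
    intro β
    have h := killingForm_apply_eq_zero_of_mem_rootSpace_of_add_ne_zero ℂ g H hmem
      (β := 0) (y := (coroot (β : Weight ℂ H g) : g))
      (LieAlgebra.toLieSubmodule_le_rootSpace_zero ℂ g H (coroot (β : Weight ℂ H g)).2)
      (by
        rw [add_zero, neg_ne_zero]
        exact isNonZero_coe α)
    simp [φ, h]
  exact ⟨φ, hφh, hφe, hφe'⟩

/-- The coordinate functional of a root vector on the integral form. -/
theorem exists_coord (B : ChevalleyBasis H) (α : H.root) :
    ∃ f : B.integralForm →ₗ[ℤ] ℤ, (∀ β, f (B.intH β) = 0) ∧ f (B.intE α) = 1 ∧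
      ∀ β, β ≠ α → f (B.intE β) = 0 := by
  obtain ⟨φ, hφh, hφe, hφe'⟩ := B.exists_complex_coord α
  let ψ : B.integralForm →ₗ[ℤ] ℂ := φ.restrictScalars ℤ ∘ₗ B.integralForm.toSubmodule.subtype
  have hψ : ∀ x, ∃ n : ℤ, (n : ℂ) = ψ x := by
    intro x
    have hx : x ∈ Submodule.span ℤ (Set.range B.intE ∪ Set.range B.intH) :=
      B.span_intE_intH ▸ Submodule.mem_top
    induction hx using Submodule.span_induction with
    | zero => exact ⟨0, by simp⟩
    | add u v _ _ hu hv =>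
      obtain ⟨⟨m, hm⟩, ⟨n, hn⟩⟩ := And.intro hu hv
      exact ⟨m + n, by rw [map_add, ← hm, ← hn, Int.cast_add]⟩
    | smul t u _ hu =>
      obtain ⟨m, hm⟩ := hu
      exact ⟨t * m, by rw [map_smul, ← hm, Int.cast_mul, zsmul_eq_mul]⟩
    | mem u hu =>
      rcases hu with ⟨β, rfl⟩ | ⟨β, rfl⟩
      · by_cases hβ : β = α
        · exact ⟨1, by rw [hβ, Int.cast_one]; exact hφe.symm⟩
        · exact ⟨0, by rw [Int.cast_zero]; exact (hφe' β hβ).symm⟩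
      · exact ⟨0, by rw [Int.cast_zero]; exact (hφh β).symm⟩
  obtain ⟨f, hf⟩ := LinearMap.exists_intCast_eq ψ hψ
  have hψe : ∀ β, ψ (B.intE β) = φ (B.e β) := fun _ ↦ rfl
  have hψh : ∀ β : H.root, ψ (B.intH β) = φ (coroot (β : Weight ℂ H g) : g) := fun _ ↦ rfl
  refine ⟨f, fun β ↦ ?_, ?_, fun β hβ ↦ ?_⟩ <;> apply Int.cast_injective (α := ℂ)
  · rw [hf, hψh, hφh, Int.cast_zero]
  · rw [hf, hψe, hφe, Int.cast_one]
  · rw [hf, hψe, hφe' β hβ, Int.cast_zero]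

/-! ### Base change to the field -/

section Modular

variable {F : Type*} [Field F]

theorem isExponentiable_one_tmul (B : ChevalleyBasis H) {z : B.integralForm}
    (hz : IsExponentiable z) : IsExponentiable (1 ⊗ₜ[ℤ] z : B.modularForm F) where
  lie_four x := by
    induction x using TensorProduct.induction_on with
    | zero => simp
    | add x y hx hy => simp only [lie_add, hx, hy, add_zero]
    | tmul a u => simp [hz.lie_four]
  lie_five x y := by
    induction x using TensorProduct.induction_on with
    | zero => simp
    | add x x' hx hx' =>
      simp only [lie_add, add_lie]
      rw [add_add_add_comm, hx, hx', add_zero]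
    | tmul a u =>
      induction y using TensorProduct.induction_on with
      | zero => simp
      | add y y' hy hy' =>
        simp only [lie_add]
        rw [add_add_add_comm, hy, hy', add_zero]
      | tmul b v => simp only [LieAlgebra.ExtendScalars.bracket_tmul, one_mul, ← TensorProduct.tmul_add,
          hz.lie_five, TensorProduct.tmul_zero]
  lie_six x y := by
    induction x using TensorProduct.induction_on with
    | zero => simp
    | add x x' hx hx' => simp only [lie_add, add_lie, hx, hx', add_zero]
    | tmul a u =>
      induction y using TensorProduct.induction_on with
      | zero => simp
      | add y y' hy hy' => simp only [lie_add, hy, hy', add_zero]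
      | tmul b v => simp [hz.lie_six]

theorem span_one_tmul_intE_intH (B : ChevalleyBasis H) :
    Submodule.span F (Set.range (fun α ↦ (1 ⊗ₜ B.intE α : B.modularForm F)) ∪
      Set.range (fun α ↦ (1 ⊗ₜ B.intH α : B.modularForm F))) = ⊤ := by
  have h := congrArg (Submodule.baseChange F) B.span_intE_intH
  rw [Submodule.baseChange_span, Submodule.baseChange_top, Set.image_union, ← Set.range_comp,
    ← Set.range_comp] at h
  exact h

theorem _root_.CharP.intCast_ne_zero_of_le_four {p : ℕ} [CharP F p] (hp : p = 0 ∨ 3 < p) {m : ℤ}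
    (hm0 : m ≠ 0) (hm : -3 ≤ m) (hm' : m ≤ 4) : (m : F) ≠ 0 := by
  rw [Ne, CharP.intCast_eq_zero_iff F p]
  rintro ⟨k, rfl⟩
  rcases hp with rfl | hp
  · simp at hm0
  · have hp4 : p ≠ 4 := by
      rintro rfl
      have := CharP.char_is_prime_or_zero F 4
      norm_num at this
    have hk : k ≠ 0 := by rintro rfl; simp at hm0
    have h5 : (5 : ℤ) ≤ p := by omega
    rcases lt_or_gt_of_ne hk with hk | hk <;> nlinarith

/-- The reduction of a Chevalley basis. -/
noncomputable def rootFrame (B : ChevalleyBasis H) {p : ℕ} [CharP F p] (hp : p = 0 ∨ 3 < p) :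
    RootFrame F (B.modularForm F) H.root where
  e α := 1 ⊗ₜ B.intE α
  h α := 1 ⊗ₜ B.intH α
  a α β := (rootSystem H).pairingIn ℤ β α
  span_eq := B.span_one_tmul_intE_intH
  lie_h_e α β := by
    rw [LieAlgebra.ExtendScalars.bracket_tmul, lie_intH_intE, TensorProduct.tmul_smul,
      Int.cast_smul_eq_zsmul, mul_one]
  lie_h_h α β := by
    rw [LieAlgebra.ExtendScalars.bracket_tmul, lie_intH_intH, TensorProduct.tmul_zero]
  exists_lie_e α := (B.exists_lie_intE α).imp fun β hβ ↦ by
    rw [LieAlgebra.ExtendScalars.bracket_tmul, hβ, mul_one]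
  exists_ne_zero α := ⟨α, by
    rw [RootPairing.pairingIn_same]
    exact CharP.intCast_ne_zero_of_le_four hp (by norm_num) (by norm_num) (by norm_num)⟩
  exists_ne α β hαβ := by
    by_contra! h
    have key : ∀ γ : H.root,
        (rootSystem H).pairingIn ℤ α γ - (rootSystem H).pairingIn ℤ β γ < -3 ∨
        (rootSystem H).pairingIn ℤ α γ - (rootSystem H).pairingIn ℤ β γ > 4 ∨
        (rootSystem H).pairingIn ℤ α γ - (rootSystem H).pairingIn ℤ β γ = 0 := by
      intro γ
      by_contra! h'
      refine CharP.intCast_ne_zero_of_le_four (F := F) hp h'.2.2 h'.1 h'.2.1 ?_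
      rw [Int.cast_sub, h γ, sub_self]
    -- The value of `α - β` on the coroot of `α` can be 5, which vanishes in characteristic 5; the
    -- Cartan integers are then -3 and -1, and the coroot of `β` gives -3 instead.
    have hα := key α
    have hβ := key β
    rw [RootPairing.pairingIn_same] at hα hβ
    have hmem := (rootSystem H).pairingIn_pairingIn_mem_set_of_isCrystal_of_isRed α β
    have h22 := ((rootSystem H).pairingIn_two_two_iff ℤ α β).not.mpr hαβ
    simp only [Set.mem_insert_iff, Set.mem_singleton_iff, Prod.mk.injEq] at hmem
    omega

/-- Nonzero Cartan integers stay nonzero in `F`, so a closed set `S` is orthogonal to its complement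
over `ℂ`. By irreducibility its roots span, so the coroot of some `β ∉ S` would kill every root,
including `β` itself. -/
theorem isConnected_rootFrame (B : ChevalleyBasis H) {p : ℕ} [CharP F p] (hp : p = 0 ∨ 3 < p) :
    (B.rootFrame (F := F) hp).IsConnected := by
  intro S hS hcl
  have hcl' : ∀ α ∈ S, ∀ β, (rootSystem H).pairingIn ℤ β α ≠ 0 → β ∈ S := by
    refine fun α hα β hβ ↦ hcl α hα β (CharP.intCast_ne_zero_of_le_four hp hβ ?_ ?_) <;>
    · have := (rootSystem H).pairingIn_pairingIn_mem_set_of_isCrystal_of_isRed β α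
      simp only [Set.mem_insert_iff, Set.mem_singleton_iff, Prod.mk.injEq] at this
      omega
  have hzero : ∀ α ∈ S, ∀ β ∉ S, (rootSystem H).pairing α β = 0 := by
    intro α hα β hβ
    rw [RootPairing.pairing_eq_zero_iff', ← (rootSystem H).algebraMap_pairingIn ℤ]
    by_contra h0
    exact hβ (hcl' α hα β fun h ↦ h0 (by rw [h, map_zero]))
  have htop := (rootSystem H).span_root_image_eq_top_of_forall_orthogonal S hS fun β hβ α hα ↦ by
    have hβS : β ∉ S := fun h ↦ hβ (Submodule.subset_span ⟨β, h, rfl⟩)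
    have := hzero α hα β hβS
    exact ⟨(rootSystem H).pairing_eq_zero_iff'.mp this, this⟩
  rw [Set.eq_univ_iff_forall]
  intro β
  by_contra hβ
  have hle : Submodule.span ℂ ((rootSystem H).root '' S) ≤
      LinearMap.ker ((rootSystem H).coroot' β) := by
    rw [Submodule.span_le]
    rintro _ ⟨α, hα, rfl⟩
    rw [SetLike.mem_coe, LinearMap.mem_ker, RootPairing.root_coroot'_eq_pairing]
    exact hzero α hα β hβ
  rw [htop] at hle
  have h2 : (rootSystem H).coroot' β ((rootSystem H).root β) = 0 := hle Submodule.mem_top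
  rw [RootPairing.root_coroot'_eq_pairing, RootPairing.pairing_same] at h2
  exact two_ne_zero h2

theorem exists_isFull (B : ChevalleyBasis H) [Infinite F] {p : ℕ} [CharP F p]
    (hp : p = 0 ∨ 3 < p) {x : B.modularForm F}
    (hx : x ∉ LieAlgebra.center F (B.modularForm F)) :
    ∃ σ : B.modularForm F ≃ₗ⁅F⁆ B.modularForm F, (B.rootFrame (F := F) hp).IsFull (σ x) := by
  have : NeZero (2 : F) := ⟨by
    simpa using CharP.intCast_ne_zero_of_le_four (F := F) hp (m := 2) (by norm_num) (by norm_num)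
      (by norm_num)⟩
  have : NeZero (3 : F) := ⟨by
    simpa using CharP.intCast_ne_zero_of_le_four (F := F) hp (m := 3) (by norm_num) (by norm_num)
      (by norm_num)⟩
  choose f hfh hfe hfe' using B.exists_coord
  let coord : H.root → Module.Dual F (B.modularForm F) := fun α ↦
    (TensorProduct.AlgebraTensorModule.rid ℤ F F).toLinearMap ∘ₗ (f α).baseChange F
  refine (B.rootFrame hp).exists_isFull_of_notMem_center (B.isConnected_rootFrame hp)
    (fun α ↦ B.isExponentiable_one_tmul (B.isExponentiable_intE α)) coord (fun α β ↦ ?_)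
    (fun α β ↦ ?_) hx
  · simp [coord, rootFrame, hfh]
  · by_cases h : β = α
    · simp [coord, rootFrame, h, hfe]
    · simp [coord, rootFrame, hfe' α β h, Ne.symm h]

end Modular

end ChevalleyBasis

/-! ### Descent to the central quotient and the direct sum -/

theorem IsClassicalSimple.exists_isFull {F L : Type*} [Field F] [Infinite F] [LieRing L]
    [LieAlgebra F L] (hL : IsClassicalSimple F L) {p : ℕ} [CharP F p] (hp : p = 0 ∨ 3 < p) {x : L}
    (hx : x ≠ 0) : ∃ (ι : Type) (_ : Fintype ι) (R : RootFrame F L ι), R.IsFull x := by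
  obtain ⟨g, _, _, _, _, H, _, B, ⟨φ⟩⟩ := hL
  set Z := LieAlgebra.center F (B.modularForm F)
  let π : B.modularForm F →ₗ⁅F⁆ B.modularForm F ⧸ Z :=
    { (LieSubmodule.Quotient.mk' Z : B.modularForm F →ₗ[F] _) with map_lie' := rfl }
  let f : B.modularForm F →ₗ⁅F⁆ L := (φ.symm : _ →ₗ⁅F⁆ L).comp π
  have hf : Function.Surjective f :=
    φ.symm.surjective.comp (LieSubmodule.Quotient.surjective_mk' Z)
  obtain ⟨u, rfl⟩ := hf x
  have hu : u ∉ Z := fun hu ↦ hx <| by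
    change φ.symm (LieSubmodule.Quotient.mk' Z u) = 0
    rw [(LieSubmodule.Quotient.mk_eq_zero (N := Z)).mpr hu, map_zero]
  obtain ⟨σ, hσ⟩ := B.exists_isFull hp hu
  -- Composing the projection with `σ⁻¹` sends the full element `σ u` back to `x`; the resulting
  -- frame depends on `x`.
  have h := hσ.map (f.comp (σ.symm : _ →ₗ⁅F⁆ _)) (hf.comp σ.symm.surjective)
  rw [show (f.comp (σ.symm : _ →ₗ⁅F⁆ _)) (σ u) = f u from
    congrArg f (σ.symm_apply_apply u)] at h
  exact ⟨H.root, inferInstance, _, h⟩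

theorem mainTheorem10 {F : Type*} [Field F] [IsAlgClosed F] (p : ℕ) [CharP F p]
    (hp : p = 0 ∨ 3 < p) (n : ℕ) (𝔤 : Fin n → Type*) [∀ k, LieRing (𝔤 k)]
    [∀ k, LieAlgebra F (𝔤 k)] (h𝔤 : ∀ k, IsClassicalSimple F (𝔤 k))
    (x : ⨁ k, 𝔤 k) (hx : ∀ k, DirectSum.lieAlgebraComponent F (Fin n) 𝔤 k x ≠ 0) :
    ∃ y : ⨁ k, 𝔤 k, LieSubalgebra.lieSpan F (⨁ k, 𝔤 k) {x, y} = ⊤ := by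
  have : Infinite F := IsAlgClosed.instInfinite
  choose ι _ R hR using fun k ↦ (h𝔤 k).exists_isFull hp (hx k)
  exact (RootFrame.IsFull.directSum (R := R) hR).exists_lieSpan_eq_top
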